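/- All spaces are real. For a normed space $X$, a functional $x^*\in X^*$ is norm-attaining if there is $x_0\in X$ with $\|x_0\|=1$ and $|x^*(x_0)|=\|x^*\|$. For a Banach space $E$ and a positively homogeneous function $f\colon E^*\to\mathbb R$ (that is, $f(\lambda x^*)=\lambda f(x^*)$ for $\lambda\ge 0$), put $$\|f\|_{FBL[E]}=\sup\Big\{\sum_{i=1}^n|f(x_i^*)| : n\in\mathbb N,\ x_1^*,\dots,x_n^*\in E^*,\ \sup_{\|x\|\le 1}\sum_{i=1}^n|x_i^*(x)|\le 1\Big\}.$$ The free Banach lattice $FBL[E]$ is the smallest closed vector sublattice, containing all evaluations $\delta_x\colon x^*\mapsto x^*(x)$ ($x\in E$), of the Banach lattice of positively homogeneous functions on $E^*$ with finite norm $\|\cdot\|_{FBL[E]}$ (pointwise order and operations). For $x^*\in E^*$, let $\delta_{x^*}\in FBL[E]^*$ be the lattice homomorphism $\delta_{x^*}(f)=f(x^*)$. Say that $E$ satisfies $(\ast)$ if for every $x^*\in E^*$: $x^*$ is norm-attaining on $E$ if and only if $\delta_{x^*}$ is norm-attaining on $FBL[E]$. A subspace $Z\subseteq E$ is an almost isometric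 ideal in $E$ if for every $\varepsilon>0$ and every finite-dimensional subspace $F\subseteq E$ there is a linear operator $T\colon F\to Z$ with $T(x)=x$ for all $x\in F\cap Z$ and $(1-\varepsilon)\|x\|\le\|T(x)\|\le(1+\varepsilon)\|x\|$ for all $x\in F$. **Theorem.** Let $E$ be a Banach space that does not satisfy $(\ast)$. Then there is a closed separable almost isometric ideal $Z$ in $E$ such that the Banach space $Z$ does not satisfy $(\ast)$. Consequently, if every separable Banach space satisfies $(\ast)$, then every Banach space satisfies $(\ast)$. -/

import Mathlib

noncomputable section

/-- A bounded linear functional on a real normed space attains its norm if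
`|φ x| = ‖φ‖` for some `x` in the unit sphere. -/
def IsNormAttaining {X : Type*} [NormedAddCommGroup X] [NormedSpace ℝ X]
    (φ : StrongDual ℝ X) : Prop :=
  ∃ x : X, ‖x‖ = 1 ∧ |φ x| = ‖φ‖

/-- `Z` is an almost isometric ideal in `E`. -/
def IsAlmostIsometricIdeal {E : Type*} [NormedAddCommGroup E] [NormedSpace ℝ E]
    (Z : Submodule ℝ E) : Prop :=
  ∀ ε : ℝ, 0 < ε → ∀ F : Submodule ℝ E, FiniteDimensional ℝ F →
    ∃ T : F →ₗ[ℝ] Z,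
      (∀ x : F, (x : E) ∈ Z → ((T x : Z) : E) = x) ∧
      ∀ x : F, (1 - ε) * ‖x‖ ≤ ‖T x‖ ∧ ‖T x‖ ≤ (1 + ε) * ‖x‖

namespace FreeBanachLattice

variable (E : Type*) [NormedAddCommGroup E] [NormedSpace ℝ E]

variable {E} in
/-- The finite families of functionals `x₁, …, xₙ` with `sup_{‖e‖ ≤ 1} ∑ |xᵢ e| ≤ 1`. -/
def Admissible {n : ℕ} (x : Fin n → StrongDual ℝ E) : Prop :=
  ∀ e : E, ‖e‖ ≤ 1 → ∑ i, |x i e| ≤ 1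

variable {E} in
/-- The set of sums whose supremum is the norm of `f` in the free Banach lattice. -/
def sums (f : StrongDual ℝ E → ℝ) : Set ℝ :=
  {s | ∃ (n : ℕ) (x : Fin n → StrongDual ℝ E), Admissible x ∧ s = ∑ i, |f (x i)|}

variable {E} in
/-- Positively homogeneous functions on the dual with finite free Banach lattice norm. -/
def IsMem (f : StrongDual ℝ E → ℝ) : Prop :=
  (∀ (c : ℝ) (x : StrongDual ℝ E), 0 ≤ c → f (c • x) = c * f x) ∧ BddAbove (sums f)

variable {E} in
theorem zero_mem_sums (f : StrongDual ℝ E → ℝ) : (0 : ℝ) ∈ sums f :=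
  ⟨0, Fin.elim0, fun _ _ => by simp, by simp⟩

variable {E} in
theorem bdd_of_le {f g h : StrongDual ℝ E → ℝ} (hf : BddAbove (sums f))
    (hg : BddAbove (sums g)) (H : ∀ x, |h x| ≤ |f x| + |g x|) : BddAbove (sums h) := by
  obtain ⟨a, ha⟩ := hf
  obtain ⟨b, hb⟩ := hg
  refine ⟨a + b, ?_⟩
  rintro s ⟨n, x, hx, rfl⟩
  have h1 := ha ⟨n, x, hx, rfl⟩
  have h2 := hb ⟨n, x, hx, rfl⟩
  calc ∑ i, |h (x i)| ≤ ∑ i, (|f (x i)| + |g (x i)|) := Finset.sum_le_sum fun i _ => H (x i)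
    _ ≤ a + b := by rw [Finset.sum_add_distrib]; exact add_le_add h1 h2

variable {E} in
theorem IsMem.add {f g : StrongDual ℝ E → ℝ} (hf : IsMem f) (hg : IsMem g) :
    IsMem (f + g) :=
  ⟨fun c x hc => by simp only [Pi.add_apply, hf.1 c x hc, hg.1 c x hc, mul_add],
    bdd_of_le hf.2 hg.2 fun x => abs_add_le _ _⟩

variable {E} in
theorem IsMem.sup {f g : StrongDual ℝ E → ℝ} (hf : IsMem f) (hg : IsMem g) :
    IsMem (f ⊔ g) :=
  ⟨fun c x hc => by
      simp only [Pi.sup_apply, hf.1 c x hc, hg.1 c x hc]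
      exact (mul_max_of_nonneg _ _ hc).symm,
    bdd_of_le hf.2 hg.2 fun x => by
      refine (abs_max_le_max_abs_abs).trans ?_
      exact max_le (le_add_of_nonneg_right (abs_nonneg _)) (le_add_of_nonneg_left (abs_nonneg _))⟩

variable {E} in
theorem IsMem.inf {f g : StrongDual ℝ E → ℝ} (hf : IsMem f) (hg : IsMem g) :
    IsMem (f ⊓ g) :=
  ⟨fun c x hc => by
      simp only [Pi.inf_apply, hf.1 c x hc, hg.1 c x hc]
      exact (mul_min_of_nonneg _ _ hc).symm,
    bdd_of_le hf.2 hg.2 fun x => by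
      refine (abs_min_le_max_abs_abs).trans ?_
      exact max_le (le_add_of_nonneg_right (abs_nonneg _)) (le_add_of_nonneg_left (abs_nonneg _))⟩

variable {E} in
theorem sums_smul_le {f : StrongDual ℝ E → ℝ} (hf : BddAbove (sums f)) (r : ℝ) :
    ∀ s ∈ sums (r • f), s ≤ |r| * sSup (sums f) := by
  rintro s ⟨n, x, hx, rfl⟩
  have h1 := le_csSup hf ⟨n, x, hx, rfl⟩
  calc ∑ i, |(r • f) (x i)| = |r| * ∑ i, |f (x i)| := by
        simp [Finset.mul_sum, abs_mul]
    _ ≤ _ := mul_le_mul_of_nonneg_left h1 (abs_nonneg r)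

/-- The vector space of positively homogeneous functions with finite norm. -/
def ambientSubmodule : Submodule ℝ (StrongDual ℝ E → ℝ) where
  carrier := {f | IsMem f}
  add_mem' := fun hf hg => IsMem.add hf hg
  zero_mem' := ⟨by simp, 0, by rintro s ⟨n, x, -, rfl⟩; simp⟩
  smul_mem' := fun r f hf =>
    ⟨fun c x hc => by
        simp only [Pi.smul_apply, smul_eq_mul, hf.1 c x hc]; ring,
      ⟨_, sums_smul_le hf.2 r⟩⟩

/-- The Banach lattice of positively homogeneous functions on the dual of `E` with finite
norm, with pointwise operations and order. (A type synonym, so that it does not carry the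
topology of pointwise convergence.) -/
def Ambient : Type _ := ↥(ambientSubmodule E)

instance : AddCommGroup (Ambient E) := inferInstanceAs (AddCommGroup ↥(ambientSubmodule E))

instance : Module ℝ (Ambient E) := inferInstanceAs (Module ℝ ↥(ambientSubmodule E))

instance : Lattice (Ambient E) :=
  Subtype.lattice (P := fun f : StrongDual ℝ E → ℝ => IsMem f)
    (fun _ _ hf hg => hf.sup hg) (fun _ _ hf hg => hf.inf hg)

instance : CoeFun (Ambient E) (fun _ => StrongDual ℝ E → ℝ) := ⟨fun f => f.1⟩

/-- `‖f‖ = sup {∑ |f xᵢ| : sup_{‖e‖ ≤ 1} ∑ |xᵢ e| ≤ 1}`. -/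
instance : Norm (Ambient E) := ⟨fun f => sSup (sums f.1)⟩

variable {E}

theorem sum_le_norm (f : Ambient E) {n : ℕ} (x : Fin n → StrongDual ℝ E) (hx : Admissible x) :
    ∑ i, |f (x i)| ≤ ‖f‖ :=
  le_csSup f.2.2 ⟨n, x, hx, rfl⟩

theorem norm_le (f : Ambient E) {a : ℝ} (h : ∀ s ∈ sums f.1, s ≤ a) : ‖f‖ ≤ a :=
  csSup_le ⟨0, zero_mem_sums f.1⟩ h

theorem norm_nonneg_aux (f : Ambient E) : 0 ≤ ‖f‖ :=
  le_csSup f.2.2 (zero_mem_sums f.1)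

theorem abs_apply_le (f : Ambient E) (x : StrongDual ℝ E) : |f x| ≤ ‖x‖ * ‖f‖ := by
  have key : ∀ y : StrongDual ℝ E, ‖y‖ ≤ 1 → |f y| ≤ ‖f‖ := by
    intro y hy
    have := sum_le_norm f (fun _ : Fin 1 => y) (fun e he => by
      have h1 := y.le_opNorm e
      have h2 : ‖y‖ * ‖e‖ ≤ 1 := mul_le_one₀ hy (norm_nonneg e) he
      simpa using h1.trans h2)
    simpa using this
  by_cases hx : x = 0
  · have h0 : f (0 : StrongDual ℝ E) = 0 := by
      have := f.2.1 0 0 le_rfl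
      simpa using this
    subst hx
    simp only [h0]
    simp
  · have hpos : 0 < ‖x‖ := norm_pos_iff.mpr hx
    have h1 := key (‖x‖⁻¹ • x) (by
      rw [norm_smul, norm_inv, norm_norm, inv_mul_cancel₀ hpos.ne'])
    have h2 : f x = ‖x‖ * f (‖x‖⁻¹ • x) := by
      rw [← f.2.1 _ _ hpos.le, smul_smul, mul_inv_cancel₀ hpos.ne', one_smul]
    rw [h2, abs_mul, abs_of_pos hpos]
    exact mul_le_mul_of_nonneg_left h1 hpos.le

theorem norm_smul_le_aux (r : ℝ) (f : Ambient E) : ‖r • f‖ ≤ |r| * ‖f‖ :=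
  norm_le _ (sums_smul_le f.2.2 r)

theorem core : NormedSpace.Core ℝ (Ambient E) where
  norm_nonneg := norm_nonneg_aux
  norm_smul := fun r f => by
    refine le_antisymm (norm_smul_le_aux r f) ?_
    by_cases hr : r = 0
    · subst hr
      simpa using norm_nonneg_aux ((0 : ℝ) • f)
    · have h := norm_smul_le_aux r⁻¹ (r • f)
      rw [smul_smul, inv_mul_cancel₀ hr, one_smul, abs_inv] at h
      have hpos : 0 < |r| := abs_pos.mpr hr
      calc ‖r‖ * ‖f‖ ≤ |r| * (|r|⁻¹ * ‖r • f‖) := mul_le_mul_of_nonneg_left h hpos.le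
        _ = ‖r • f‖ := by rw [← mul_assoc, mul_inv_cancel₀ hpos.ne', one_mul]
  norm_triangle := fun f g => norm_le _ (by
    rintro s ⟨n, x, hx, rfl⟩
    calc ∑ i, |(f + g).1 (x i)| ≤ ∑ i, (|f (x i)| + |g (x i)|) :=
          Finset.sum_le_sum fun i _ => abs_add_le _ _
      _ ≤ ‖f‖ + ‖g‖ := by
          rw [Finset.sum_add_distrib]
          exact add_le_add (sum_le_norm f x hx) (sum_le_norm g x hx))
  norm_eq_zero_iff := fun f => by
    constructor
    · intro h
      refine Subtype.ext (funext fun x => ?_)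
      have := abs_apply_le f x
      rw [h, mul_zero] at this
      exact abs_nonpos_iff.mp this
    · rintro rfl
      refine le_antisymm (norm_le _ ?_) (norm_nonneg_aux _)
      rintro s ⟨n, x, -, rfl⟩
      exact (Finset.sum_eq_zero fun i _ => abs_zero).le

instance : NormedAddCommGroup (Ambient E) := NormedAddCommGroup.ofCore core

instance : NormedSpace ℝ (Ambient E) := NormedSpace.ofCore core

/-- The evaluation function `δ_e : x ↦ x e` on the dual of `E`. -/
def evalAt (e : E) : Ambient E :=
  ⟨fun x => x e, fun c x _ => by simp, ‖e‖, by
    rintro s ⟨n, x, hx, rfl⟩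
    by_cases he : e = 0
    · simp [he]
    · have hpos : 0 < ‖e‖ := norm_pos_iff.mpr he
      have h := hx (‖e‖⁻¹ • e) (by
        rw [norm_smul, norm_inv, norm_norm, inv_mul_cancel₀ hpos.ne'])
      simp only [map_smul, smul_eq_mul, abs_mul, abs_inv, abs_norm, ← Finset.mul_sum] at h
      calc ∑ i, |x i e| = ‖e‖ * (‖e‖⁻¹ * ∑ i, |x i e|) := by
            rw [← mul_assoc, mul_inv_cancel₀ hpos.ne', one_mul]
        _ ≤ ‖e‖ := mul_le_of_le_one_right hpos.le h⟩

variable (E)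

/-- The free Banach lattice `FBL[E]`: the smallest closed vector sublattice of the Banach
lattice of positively homogeneous functions with finite norm that contains every `δ_e`. -/
def fbl : Submodule ℝ (Ambient E) :=
  sInf {S | IsClosed (S : Set (Ambient E)) ∧ SupClosed (S : Set (Ambient E)) ∧
    InfClosed (S : Set (Ambient E)) ∧ ∀ e : E, evalAt e ∈ S}

variable {E}

/-- The functional `δ_x : f ↦ f x` on `FBL[E]`, for `x` in the dual of `E`. -/
def delta (x : StrongDual ℝ E) : StrongDual ℝ (fbl E) :=
  LinearMap.mkContinuous
    { toFun := fun f => (f : Ambient E) x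
      map_add' := fun _ _ => rfl
      map_smul' := fun _ _ => rfl } ‖x‖ fun f => abs_apply_le f.1 x

end FreeBanachLattice

/-- The equivalence for `E`: a functional `x` on `E` attains its norm if and only if
`δ_x` attains its norm on `FBL[E]`. -/
def NormAttainingEquivalence (E : Type*) [NormedAddCommGroup E] [NormedSpace ℝ E] : Prop :=
  ∀ x : StrongDual ℝ E, IsNormAttaining x ↔ IsNormAttaining (FreeBanachLattice.delta x)

end

universe u

/-! Since `‖δ_x‖ = ‖x‖`, a unit vector where `x` attains its norm yields an evaluation where `δ_x`
does. So (∗) can only fail through some `x` that is not norm-attaining although `δ_x` attains its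
norm at a unit vector `f`; such an `x` is nonzero (`isNormAttaining_zero_of_delta`).

This failure depends on countable data: `f` is generated by countably many evaluations
(`exists_countable_mem_fblOn`), and `‖x‖` is determined by a countable set
(`exists_countable_norming`). Let `Z` be a closed separable almost isometric ideal containing both
sets. Then `x|_Z` has norm `‖x‖` and cannot attain it. Taking limits of `y ∘ T_i` along an
ultrafilter gives a linear extension operator `φ : Z* → E*` preserving admissible families
(`exists_extension`). Composition with `φ` is a contraction that fixes evaluations at points of `Z`,
so it sends `f` into `FBL[Z]` without changing its value at `x` (`compOp_mem_fbl`). Hence `δ_{x|_Z}`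
attains its norm there.

The ideal `Z` comes from a Löwenheim–Skolem argument: norms of combinations of tuples are points of
a separable space of continuous functions, so countably many tuples suffice at each stage; iterate
and take the closure. -/

noncomputable section

namespace FreeBanachLattice

/-! ### Countable generation, evaluation functionals and composition operators -/

section

variable {E : Type*} [NormedAddCommGroup E] [NormedSpace ℝ E]

/-- The smallest closed vector sublattice containing the evaluations at the points of `A`. -/
def fblOn (A : Set E) : Submodule ℝ (Ambient E) :=
  sInf {S | IsClosed (S : Set (Ambient E)) ∧ SupClosed (S : Set (Ambient E)) ∧
    InfClosed (S : Set (Ambient E)) ∧ ∀ e ∈ A, evalAt e ∈ S}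

theorem mem_fblOn {A : Set E} {f : Ambient E} :
    f ∈ fblOn A ↔ ∀ S : Submodule ℝ (Ambient E), IsClosed (S : Set (Ambient E)) →
      SupClosed (S : Set (Ambient E)) → InfClosed (S : Set (Ambient E)) →
      (∀ e ∈ A, evalAt e ∈ S) → f ∈ S := by
  simp only [fblOn, Submodule.mem_sInf, Set.mem_ofPred_eq, and_imp]

theorem fblOn_univ : fblOn (Set.univ : Set E) = fbl E := by
  simp [fblOn, fbl]

theorem isClosed_fblOn (A : Set E) : IsClosed (fblOn A : Set (Ambient E)) := by
  rw [fblOn, Submodule.coe_sInf]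
  exact isClosed_biInter fun S hS => hS.1

theorem supClosed_fblOn (A : Set E) : SupClosed (fblOn A : Set (Ambient E)) := by
  intro f hf g hg
  exact mem_fblOn.2 fun S h1 h2 h3 h4 =>
    h2 (mem_fblOn.1 hf S h1 h2 h3 h4) (mem_fblOn.1 hg S h1 h2 h3 h4)

theorem infClosed_fblOn (A : Set E) : InfClosed (fblOn A : Set (Ambient E)) := by
  intro f hf g hg
  exact mem_fblOn.2 fun S h1 h2 h3 h4 =>
    h3 (mem_fblOn.1 hf S h1 h2 h3 h4) (mem_fblOn.1 hg S h1 h2 h3 h4)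

theorem evalAt_mem_fblOn {A : Set E} {e : E} (he : e ∈ A) : evalAt e ∈ fblOn A :=
  mem_fblOn.2 fun _ _ _ _ h => h e he

theorem fblOn_mono {A B : Set E} (h : A ⊆ B) : fblOn A ≤ fblOn B := fun _ hf =>
  mem_fblOn.2 fun S h1 h2 h3 h4 => mem_fblOn.1 hf S h1 h2 h3 fun e he => h4 e (h he)

/-- Every element of the free Banach lattice is generated by countably many evaluations. -/
theorem exists_countable_mem_fblOn {f : Ambient E} (hf : f ∈ fbl E) :
    ∃ A : Set E, A.Countable ∧ f ∈ fblOn A := by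
  -- The countably generated elements form a closed sublattice: a limit of a sequence only needs the
  -- union of countably many countable sets.
  let S : Submodule ℝ (Ambient E) :=
    { carrier := {f | ∃ A : Set E, A.Countable ∧ f ∈ fblOn A}
      add_mem' := by
        rintro f g ⟨A, hA, hf⟩ ⟨B, hB, hg⟩
        exact ⟨A ∪ B, hA.union hB, add_mem (fblOn_mono Set.subset_union_left hf)
          (fblOn_mono Set.subset_union_right hg)⟩
      zero_mem' := ⟨∅, Set.countable_empty, zero_mem _⟩
      smul_mem' := by
        rintro r f ⟨A, hA, hf⟩
        exact ⟨A, hA, Submodule.smul_mem _ r hf⟩ }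
  rw [← fblOn_univ] at hf
  refine mem_fblOn.1 hf S ?_ ?_ ?_ ?_
  · refine IsSeqClosed.isClosed fun u g hu hg => ?_
    choose A hA hu using hu
    refine ⟨⋃ n, A n, Set.countable_iUnion hA, (isClosed_fblOn _).mem_of_tendsto hg
      (Filter.Eventually.of_forall fun n => fblOn_mono (Set.subset_iUnion A n) (hu n))⟩
  · rintro f ⟨A, hA, hf⟩ g ⟨B, hB, hg⟩
    exact ⟨A ∪ B, hA.union hB, supClosed_fblOn _ (fblOn_mono Set.subset_union_left hf)
      (fblOn_mono Set.subset_union_right hg)⟩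
  · rintro f ⟨A, hA, hf⟩ g ⟨B, hB, hg⟩
    exact ⟨A ∪ B, hA.union hB, infClosed_fblOn _ (fblOn_mono Set.subset_union_left hf)
      (fblOn_mono Set.subset_union_right hg)⟩
  · intro e _
    exact ⟨{e}, Set.countable_singleton e, evalAt_mem_fblOn rfl⟩

theorem norm_evalAt_le (e : E) : ‖evalAt e‖ ≤ ‖e‖ := by
  refine norm_le _ ?_
  rintro s ⟨n, x, hx, rfl⟩
  by_cases he : e = 0
  · simp [he, evalAt]
  · have hpos : 0 < ‖e‖ := norm_pos_iff.mpr he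
    have h := hx (‖e‖⁻¹ • e) (by
      rw [norm_smul, norm_inv, norm_norm, inv_mul_cancel₀ hpos.ne'])
    simp only [map_smul, smul_eq_mul, abs_mul, abs_inv, abs_norm, ← Finset.mul_sum] at h
    rwa [inv_mul_le_iff₀ hpos, mul_one] at h

theorem evalAt_mem_fbl (e : E) : evalAt e ∈ fbl E := by
  rw [← fblOn_univ]
  exact evalAt_mem_fblOn (Set.mem_univ e)

/-- The lower bound comes from testing on evaluations, since `δ_x(δ_e) = x e` and `‖δ_e‖ ≤ ‖e‖`. -/
theorem norm_delta (x : StrongDual ℝ E) : ‖delta x‖ = ‖x‖ := by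
  refine le_antisymm (LinearMap.mkContinuous_norm_le _ (norm_nonneg x) _) ?_
  refine x.opNorm_le_bound (norm_nonneg (delta x)) fun e => ?_
  have h := (delta x).le_opNorm ⟨evalAt e, evalAt_mem_fbl e⟩
  exact h.trans (mul_le_mul_of_nonneg_left (norm_evalAt_le e) (norm_nonneg (delta x)))

/-- Norm attainment of `x` passes to `δ_x`. -/
theorem isNormAttaining_delta {x : StrongDual ℝ E} (hx : IsNormAttaining x) :
    IsNormAttaining (delta x) := by
  obtain ⟨e, he, hxe⟩ := hx
  -- The point is that `‖δ_e‖ ≥ 1`. For nonzero `x` this is read off from `|x e| = ‖x‖`; for `x = 0`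
  -- a Hahn–Banach functional for `e` takes its place.
  by_cases hx0 : x = 0
  · have hne : e ≠ 0 := by
      rintro rfl
      simp at he
    obtain ⟨y, hy, hye⟩ := exists_dual_vector ℝ e (norm_ne_zero_iff.2 hne)
    refine ⟨⟨evalAt e, evalAt_mem_fbl e⟩, le_antisymm ((norm_evalAt_le e).trans he.le) ?_, ?_⟩
    · have h := abs_apply_le (evalAt e) y
      rw [hy, one_mul] at h
      refine le_trans ?_ h
      change 1 ≤ |y e|
      rw [hye]
      simp [he]
    · rw [norm_delta, ← hxe]
      rfl
  · refine ⟨⟨evalAt e, evalAt_mem_fbl e⟩, le_antisymm ((norm_evalAt_le e).trans he.le) ?_, ?_⟩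
    · have h := abs_apply_le (evalAt e) x
      have h' : |(evalAt e) x| = ‖x‖ := hxe
      rw [h'] at h
      exact le_of_mul_le_mul_left (by simpa using h) (norm_pos_iff.2 hx0)
    · rw [norm_delta, ← hxe]
      rfl

/-- Evaluation at a functional, on the ambient Banach lattice. -/
def ambientDelta (x : StrongDual ℝ E) : StrongDual ℝ (Ambient E) :=
  LinearMap.mkContinuous
    { toFun := fun f => f x
      map_add' := fun _ _ => rfl
      map_smul' := fun _ _ => rfl } ‖x‖ fun f => abs_apply_le f x

variable {F : Type*} [NormedAddCommGroup F] [NormedSpace ℝ F]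

/-- Composition with a linear map between duals that preserves admissible families. -/
def compOp (φ : StrongDual ℝ F →ₗ[ℝ] StrongDual ℝ E)
    (hφ : ∀ (n : ℕ) (x : Fin n → StrongDual ℝ F), Admissible x → Admissible fun i => φ (x i)) :
    Ambient E →L[ℝ] Ambient F :=
  LinearMap.mkContinuous
    { toFun := fun f => ⟨fun x => f (φ x), fun c x hc => by
          change f (φ (c • x)) = c * f (φ x)
          rw [map_smul]
          exact f.2.1 c _ hc, ‖f‖, by
          rintro s ⟨n, x, hx, rfl⟩
          exact sum_le_norm f _ (hφ n x hx)⟩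
      map_add' := fun _ _ => rfl
      map_smul' := fun _ _ => rfl } 1 fun f => by
    rw [one_mul]
    refine norm_le _ ?_
    rintro s ⟨n, x, hx, rfl⟩
    exact sum_le_norm f _ (hφ n x hx)

theorem norm_compOp_apply_le (φ : StrongDual ℝ F →ₗ[ℝ] StrongDual ℝ E)
    (hφ : ∀ (n : ℕ) (x : Fin n → StrongDual ℝ F), Admissible x → Admissible fun i => φ (x i))
    (f : Ambient E) : ‖compOp φ hφ f‖ ≤ ‖f‖ := by
  refine norm_le _ ?_
  rintro s ⟨n, x, hx, rfl⟩
  exact sum_le_norm f _ (hφ n x hx)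

/-- If `φ` extends functionals from `Z` to `E`, then elements generated by evaluations at points
of `Z` are mapped into the free Banach lattice of `Z`, compatibly with restriction. -/
theorem compOp_mem_fbl {Z : Submodule ℝ E} (φ : StrongDual ℝ Z →ₗ[ℝ] StrongDual ℝ E)
    (hφ : ∀ (n : ℕ) (x : Fin n → StrongDual ℝ Z), Admissible x → Admissible fun i => φ (x i))
    (hext : ∀ (y : StrongDual ℝ Z) (z : Z), φ y z = y z) {A : Set E} (hA : A ⊆ Z)
    {f : Ambient E} (hf : f ∈ fblOn A) (x : StrongDual ℝ E) :
    compOp φ hφ f ∈ fbl Z ∧ (compOp φ hφ f) (x ∘L Z.subtypeL) = f x := by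
  -- Both conclusions define closed vector sublattices, so generators suffice. The equality holds
  -- even though `φ (x|_Z)` may differ from `x`: on generators only values at points of `Z` enter.
  let S : Submodule ℝ (Ambient E) := (fbl Z).comap (compOp φ hφ).toLinearMap ⊓
    LinearMap.eqLocus ((ambientDelta (x ∘L Z.subtypeL)) ∘L compOp φ hφ).toLinearMap
      (ambientDelta x).toLinearMap
  refine mem_fblOn.1 hf S ?_ ?_ ?_ ?_
  · refine IsClosed.inter ?_ ?_
    · have h := isClosed_fblOn (Set.univ : Set Z)
      rw [fblOn_univ] at h
      exact h.preimage (compOp φ hφ).continuous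
    · exact isClosed_eq ((ambientDelta (x ∘L Z.subtypeL)) ∘L compOp φ hφ).continuous
        (ambientDelta x).continuous
  · rintro f ⟨hf, hf'⟩ g ⟨hg, hg'⟩
    refine ⟨?_, congrArg₂ (· ⊔ ·) hf' hg'⟩
    have h := supClosed_fblOn (Set.univ : Set Z)
    rw [fblOn_univ] at h
    exact h hf hg
  · rintro f ⟨hf, hf'⟩ g ⟨hg, hg'⟩
    refine ⟨?_, congrArg₂ (· ⊓ ·) hf' hg'⟩
    have h := infClosed_fblOn (Set.univ : Set Z)
    rw [fblOn_univ] at h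
    exact h hf hg
  · intro e he
    have key : compOp φ hφ (evalAt e) = evalAt (⟨e, hA he⟩ : Z) :=
      Subtype.ext (funext fun y => hext y ⟨e, hA he⟩)
    constructor
    · change compOp φ hφ (evalAt e) ∈ fbl Z
      rw [key]
      exact evalAt_mem_fbl _
    · change (compOp φ hφ (evalAt e)) (x ∘L Z.subtypeL) = x e
      rw [key]
      rfl

/-- If some `δ_x` attains its norm at an element generated by evaluations at points of `Z`, and
`Z` is norming for `x` and admits an extension operator, then the restriction of `x` to `Z` has
the same property. -/
theorem isNormAttaining_delta_restrict {Z : Submodule ℝ E}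
    (φ : StrongDual ℝ Z →ₗ[ℝ] StrongDual ℝ E)
    (hφ : ∀ (n : ℕ) (x : Fin n → StrongDual ℝ Z), Admissible x → Admissible fun i => φ (x i))
    (hext : ∀ (y : StrongDual ℝ Z) (z : Z), φ y z = y z) {A : Set E} (hA : A ⊆ Z)
    {f : Ambient E} (hf : f ∈ fblOn A) {x : StrongDual ℝ E} (hx : x ≠ 0)
    (hf1 : ‖f‖ = 1) (hfx : |f x| = ‖x‖) (hxZ : ‖x ∘L Z.subtypeL‖ = ‖x‖) :
    IsNormAttaining (delta (x ∘L Z.subtypeL)) := by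
  obtain ⟨h1, h2⟩ := compOp_mem_fbl φ hφ hext hA hf x
  refine ⟨⟨_, h1⟩, le_antisymm ((norm_compOp_apply_le φ hφ f).trans hf1.le) ?_, ?_⟩
  -- The contraction cannot shrink `f`, because the value `‖x‖` at a functional of norm `‖x‖` forces
  -- norm at least one.
  · have h := abs_apply_le (compOp φ hφ f) (x ∘L Z.subtypeL)
    rw [h2, hfx, hxZ] at h
    exact le_of_mul_le_mul_left (by simpa using h) (norm_pos_iff.2 hx)
  · rw [norm_delta, hxZ, ← hfx, ← h2]
    rfl

end

/-! ### Extension operators from almost isometric ideals -/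

section

variable {E : Type*} [NormedAddCommGroup E] [NormedSpace ℝ E]

open Filter Topology

/-- An almost isometric ideal admits, along an ultrafilter, linear maps into it that are
asymptotically contractive and asymptotically fix its points. -/
theorem exists_ultrafilter_approx {Z : Submodule ℝ E} (hZ : IsAlmostIsometricIdeal Z) :
    ∃ (U : Ultrafilter (Finset E × ℕ)) (T : Finset E × ℕ → E →ₗ[ℝ] Z),
      (∀ z : Z, ∀ᶠ i in (U : Filter (Finset E × ℕ)), T i z = z) ∧
      ∀ e, ∀ n : ℕ, ∀ᶠ i in (U : Filter (Finset E × ℕ)), ‖T i e‖ ≤ (1 + 1 / (n + 1 : ℝ)) * ‖e‖ := by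
  classical
  have h : ∀ i : Finset E × ℕ, ∃ T : E →ₗ[ℝ] Z,
      (∀ z : Z, (z : E) ∈ Submodule.span ℝ (i.1 : Set E) → T z = z) ∧
      ∀ e ∈ Submodule.span ℝ (i.1 : Set E), ‖T e‖ ≤ (1 + 1 / (i.2 + 1 : ℝ)) * ‖e‖ := by
    intro i
    obtain ⟨T, hT1, hT2⟩ := hZ (1 / (i.2 + 1 : ℝ)) (by positivity)
      (Submodule.span ℝ (i.1 : Set E)) (FiniteDimensional.span_finset ℝ i.1)
    -- The extension is arbitrary off the span; each vector eventually lies in the span, so this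
    -- does no harm in the limit.
    obtain ⟨T', hT'⟩ := T.exists_extend
    have hT'' : ∀ e (he : e ∈ Submodule.span ℝ (i.1 : Set E)), T' e = T ⟨e, he⟩ :=
      fun e he => LinearMap.congr_fun hT' ⟨e, he⟩
    refine ⟨T', fun z hz => ?_, fun e he => ?_⟩
    · rw [hT'' _ hz]
      exact Subtype.ext (hT1 ⟨z, hz⟩ z.2)
    · rw [hT'' _ he]
      exact (hT2 ⟨e, he⟩).2
  choose T hT1 hT2 using h
  have hmem : ∀ e : E, ∀ᶠ i in (Ultrafilter.of (atTop : Filter (Finset E × ℕ)) :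
      Filter (Finset E × ℕ)), e ∈ Submodule.span ℝ (i.1 : Set E) := by
    intro e
    refine Ultrafilter.of_le _ ?_
    filter_upwards [eventually_ge_atTop (({e}, 0) : Finset E × ℕ)] with i hi
    exact Submodule.subset_span (hi.1 (Finset.mem_singleton_self e))
  have hn : ∀ n : ℕ, ∀ᶠ i in (Ultrafilter.of (atTop : Filter (Finset E × ℕ)) :
      Filter (Finset E × ℕ)), n ≤ i.2 := by
    intro n
    refine Ultrafilter.of_le _ ?_
    filter_upwards [eventually_ge_atTop ((∅, n) : Finset E × ℕ)] with i hi
    exact hi.2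
  refine ⟨Ultrafilter.of atTop, T, fun z => ?_, fun e n => ?_⟩
  · filter_upwards [hmem z] with i hi
    exact hT1 i z hi
  · filter_upwards [hmem e, hn n] with i hi hin
    refine (hT2 i e hi).trans (mul_le_mul_of_nonneg_right ?_ (norm_nonneg _))
    have := one_div_le_one_div_of_le (α := ℝ) (a := n + 1) (b := i.2 + 1) (by positivity)
      (by exact_mod_cast Nat.succ_le_succ hin)
    linarith

/-- Functionals on an almost isometric ideal extend linearly to the whole space, preserving
admissible families. -/
theorem exists_extension {Z : Submodule ℝ E} (hZ : IsAlmostIsometricIdeal Z) :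
    ∃ φ : StrongDual ℝ Z →ₗ[ℝ] StrongDual ℝ E,
      (∀ (n : ℕ) (x : Fin n → StrongDual ℝ Z), Admissible x → Admissible fun i => φ (x i)) ∧
      ∀ (y : StrongDual ℝ Z) (z : Z), φ y z = y z := by
  obtain ⟨U, T, hTZ, hTn⟩ := exists_ultrafilter_approx hZ
  have hbd : ∀ (y : StrongDual ℝ Z) (e : E), ∀ᶠ i in (U : Filter (Finset E × ℕ)),
      |y (T i e)| ≤ ‖y‖ * (2 * ‖e‖) := by
    intro y e
    filter_upwards [hTn e 0] with i hi
    refine (y.le_opNorm _).trans (mul_le_mul_of_nonneg_left (hi.trans_eq ?_) (norm_nonneg _))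
    norm_num
  have hlim : ∀ (y : StrongDual ℝ Z) (e : E), ∃ l, Tendsto (fun i => y (T i e)) U (𝓝 l) := by
    intro y e
    obtain ⟨l, -, hl⟩ := (isCompact_Icc (a := -(‖y‖ * (2 * ‖e‖)))
      (b := ‖y‖ * (2 * ‖e‖))).ultrafilter_le_nhds (U.map fun i => y (T i e)) (by
        rw [le_principal_iff]
        exact (hbd y e).mono fun i hi => abs_le.1 hi)
    exact ⟨l, hl⟩
  choose p hp using hlim
  have hpadd : ∀ y e e', p y (e + e') = p y e + p y e' := fun y e e' =>
    tendsto_nhds_unique ((hp y (e + e')).congr fun i => by rw [map_add, map_add])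
      ((hp y e).add (hp y e'))
  have hpsmul : ∀ y (c : ℝ) e, p y (c • e) = c * p y e := fun y c e =>
    tendsto_nhds_unique ((hp y (c • e)).congr fun i => by rw [map_smul, map_smul, smul_eq_mul])
      ((hp y e).const_mul c)
  have hpbd : ∀ y e, |p y e| ≤ ‖y‖ * (2 * ‖e‖) := fun y e =>
    le_of_tendsto (hp y e).abs (hbd y e)
  let φ : StrongDual ℝ Z →ₗ[ℝ] StrongDual ℝ E :=
    { toFun := fun y => LinearMap.mkContinuous
        { toFun := p y
          map_add' := hpadd y
          map_smul' := hpsmul y } (‖y‖ * 2) fun e => by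
            rw [mul_assoc]
            exact hpbd y e
      map_add' := fun y y' => ContinuousLinearMap.ext fun e =>
        tendsto_nhds_unique (hp (y + y') e) ((hp y e).add (hp y' e))
      map_smul' := fun c y => ContinuousLinearMap.ext fun e =>
        tendsto_nhds_unique (hp (c • y) e) ((hp y e).const_mul c) }
  refine ⟨φ, ?_, ?_⟩
  · intro n x hx e he
    change ∑ i, |p (x i) e| ≤ 1
    have hx' : ∀ z : Z, ∑ i, |x i z| ≤ ‖z‖ := by
      intro z
      by_cases hz : z = 0
      · simp [hz]
      · have hpos : 0 < ‖z‖ := norm_pos_iff.mpr hz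
        have h := hx (‖z‖⁻¹ • z) (by
          rw [norm_smul, norm_inv, norm_norm, inv_mul_cancel₀ hpos.ne'])
        simp only [map_smul, smul_eq_mul, abs_mul, abs_inv, abs_norm, ← Finset.mul_sum] at h
        rwa [inv_mul_le_iff₀ hpos, mul_one] at h
    -- Admissibility needs constant exactly 1, so the limit bound is taken for every precision `m`.
    have h1 : ∀ m : ℕ, ∑ i, |p (x i) e| ≤ 1 + 1 / (m + 1 : ℝ) := fun m =>
      le_of_tendsto (tendsto_finsetSum _ fun i _ => (hp (x i) e).abs) (by
        filter_upwards [hTn e m] with i hi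
        exact (hx' _).trans (hi.trans (mul_le_of_le_one_right (by positivity) he)))
    refine ge_of_tendsto' (x := atTop) (f := fun m : ℕ => 1 + 1 / (m + 1 : ℝ)) ?_ h1
    simpa using tendsto_one_div_add_atTop_nhds_zero_nat.const_add (1 : ℝ)
  · intro y z
    refine tendsto_nhds_unique (hp y z) (tendsto_const_nhds.congr' ?_)
    filter_upwards [hTZ z] with i hi
    rw [hi]

end

/-! ### Separable subspaces imitating the whole space -/

section

variable {E : Type*} [NormedAddCommGroup E] [NormedSpace ℝ E]

open Filter Topology TopologicalSpace

/-- The norms of the linear combinations of `a` and `y` with coefficients in the unit ball. -/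
def combinationNorm {m k : ℕ} (a : Fin m → E) (y : Fin k → E) :
    C(Metric.closedBall (0 : (Fin m → ℝ) × (Fin k → ℝ)) 1, ℝ) :=
  ⟨fun c => ‖∑ i, c.1.1 i • a i + ∑ j, c.1.2 j • y j‖, by fun_prop⟩

theorem norm_sum_smul_sub_le {m : ℕ} (c : Fin m → ℝ) (hc : ‖c‖ ≤ 1) (a b : Fin m → E)
    {η : ℝ} (hab : ∀ i, ‖a i - b i‖ ≤ η) :
    ‖∑ i, c i • a i - ∑ i, c i • b i‖ ≤ m * η := by
  rw [← Finset.sum_sub_distrib]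
  refine (norm_sum_le _ _).trans ?_
  refine (Finset.sum_le_card_nsmul Finset.univ (fun i => ‖c i • a i - c i • b i‖) η
    fun i _ => ?_).trans (by simp)
  rw [← smul_sub, norm_smul]
  exact (mul_le_of_le_one_left (norm_nonneg (a i - b i)) ((norm_le_pi_norm c i).trans hc)).trans (hab i)

theorem abs_combinationNorm_sub_le {m k : ℕ} (a b : Fin m → E) (y : Fin k → E)
    {η : ℝ} (hab : ∀ i, ‖a i - b i‖ ≤ η) (c) :
    |combinationNorm a y c - combinationNorm b y c| ≤ m * η := by
  refine (abs_norm_sub_norm_le (∑ i, c.1.1 i • a i + ∑ j, c.1.2 j • y j)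
    (∑ i, c.1.1 i • b i + ∑ j, c.1.2 j • y j)).trans ?_
  rw [add_sub_add_right_eq_sub]
  refine norm_sum_smul_sub_le c.1.1 ?_ a b hab
  have := c.2
  rw [mem_closedBall_zero_iff] at this
  exact (le_max_left _ _).trans this

/-- Given a separable set `Y`, countably many points of `E` suffice to imitate, up to any
precision, the position of every tuple of points of `E` over every tuple of points of `Y`. -/
theorem exists_countable_imitating {Y : Set E} (hY : IsSeparable Y) :
    ∃ D : Set E, D.Countable ∧ ∀ (m k : ℕ) (a : Fin m → E) (y : Fin k → E), (∀ i, a i ∈ Y) →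
      ∀ η > 0, ∃ d : Fin k → E, (∀ j, d j ∈ D) ∧
        ∀ c, |combinationNorm a y c - combinationNorm a d c| ≤ η := by
  have hYs : SeparableSpace Y := hY.separableSpace
  have hYc : SecondCountableTopology Y := UniformSpace.secondCountable_of_separable Y
  have key : ∀ m k : ℕ, ∃ D : Set E, D.Countable ∧ ∀ (a : Fin m → E) (y : Fin k → E),
      (∀ i, a i ∈ Y) → ∀ η > 0, ∃ d : Fin k → E, (∀ j, d j ∈ D) ∧
        ∀ c, |combinationNorm a y c - combinationNorm a d c| ≤ η := by
    intro m k
    -- The target is separable metrizable, so the range has a countable dense subset. Recording the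
    -- tuple over `Y` ensures that the approximating pair has its own tuple close to `a`.
    let G : (Fin m → Y) × (Fin k → E) → (Fin m → Y) ×
        C(Metric.closedBall (0 : (Fin m → ℝ) × (Fin k → ℝ)) 1, ℝ) :=
      fun p => (p.1, combinationNorm (fun i => (p.1 i : E)) p.2)
    obtain ⟨s, hs, hsd⟩ := exists_countable_dense (Set.range G)
    choose q hq using fun r : Set.range G => r.2
    refine ⟨⋃ r ∈ s, Set.range (q r).2, hs.biUnion fun r _ => Set.countable_range _, ?_⟩
    intro a y ha η hη
    -- One share for the distance of the norm functions, `m` for replacing the tuple over `Y`.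
    have hη' : 0 < η / (m + 1) := by positivity
    obtain ⟨r, hrs, hr⟩ := Metric.mem_closure_iff.1
      (hsd ⟨G (fun i => ⟨a i, ha i⟩, y), Set.mem_range_self _⟩) _ hη'
    refine ⟨(q r).2, fun j => Set.mem_biUnion hrs (Set.mem_range_self j), fun c => ?_⟩
    rw [Subtype.dist_eq, ← hq r, Prod.dist_eq, max_lt_iff] at hr
    have h1 : ∀ i, ‖((q r).1 i : E) - a i‖ ≤ η / (m + 1) := fun i => by
      rw [← dist_eq_norm, dist_comm]
      exact (dist_le_pi_dist (fun i => (⟨a i, ha i⟩ : Y)) (q r).1 i).trans hr.1.le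
    have h2 : |combinationNorm a y c - combinationNorm (fun i => ((q r).1 i : E)) (q r).2 c|
        ≤ η / (m + 1) := (ContinuousMap.dist_apply_le_dist c).trans hr.2.le
    have h3 := abs_combinationNorm_sub_le _ a (q r).2 h1 c
    have h4 : η / (m + 1) + m * (η / (m + 1)) = η := by
      field_simp
      ring
    exact (abs_sub_le _ _ _).trans ((add_le_add h2 h3).trans h4.le)
  choose D hD hD' using key
  refine ⟨⋃ m, ⋃ k, D m k, Set.countable_iUnion fun m => Set.countable_iUnion fun k => hD m k, ?_⟩
  intro m k a y ha η hη
  obtain ⟨d, hd, h⟩ := hD' m k a y ha η hη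
  exact ⟨d, fun j => Set.mem_iUnion₂.2 ⟨m, k, hd j⟩, h⟩

/-- Every countable set lies in a closed separable subspace that imitates, up to any precision,
the position of tuples of points of `E` over tuples in the subspace. -/
theorem exists_imitating_submodule {A : Set E} (hA : A.Countable) :
    ∃ Z : Submodule ℝ E, A ⊆ Z ∧ IsClosed (Z : Set E) ∧ SeparableSpace Z ∧
      ∀ (m k : ℕ) (a : Fin m → E) (y : Fin k → E), (∀ i, a i ∈ Z) →
        ∀ η > 0, ∃ d : Fin k → E, (∀ j, d j ∈ Z) ∧
          ∀ c, |combinationNorm a y c - combinationNorm a d c| ≤ η := by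
  have h : ∀ Y : Submodule ℝ E, ∃ Y' : Submodule ℝ E, Y ≤ Y' ∧ (IsSeparable (Y : Set E) →
      IsSeparable (Y' : Set E) ∧ ∀ (m k : ℕ) (a : Fin m → E) (y : Fin k → E), (∀ i, a i ∈ Y) →
        ∀ η > 0, ∃ d : Fin k → E, (∀ j, d j ∈ Y') ∧
          ∀ c, |combinationNorm a y c - combinationNorm a d c| ≤ η) := by
    intro Y
    by_cases hY : IsSeparable (Y : Set E)
    · obtain ⟨D, hD, hD'⟩ := exists_countable_imitating hY
      refine ⟨Submodule.span ℝ ((Y : Set E) ∪ D),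
        Set.subset_union_left.trans Submodule.subset_span,
        fun _ => ⟨(hY.union hD.isSeparable).span (R := ℝ), fun m k a y ha η hη => ?_⟩⟩
      obtain ⟨d, hd, h⟩ := hD' m k a y ha η hη
      exact ⟨d, fun j => Submodule.subset_span (Or.inr (hd j)), h⟩
    · exact ⟨Y, le_rfl, fun h => absurd h hY⟩
  choose S hS hS' using h
  obtain ⟨W, hW0, hW⟩ : ∃ W : ℕ → Submodule ℝ E, W 0 = Submodule.span ℝ A ∧
      ∀ n, W (n + 1) = S (W n) :=
    ⟨fun n => Nat.rec (Submodule.span ℝ A) (fun _ => S) n, rfl, fun _ => rfl⟩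
  have hsep : ∀ n, IsSeparable (W n : Set E) := by
    intro n
    induction n with
    | zero =>
      rw [hW0]
      exact hA.isSeparable.span (R := ℝ)
    | succ n ih =>
      rw [hW]
      exact (hS' _ ih).1
  have hmono : Monotone W := monotone_nat_of_le_succ fun n => by
    rw [hW]
    exact hS _
  have hcoe : ((⨆ n, W n : Submodule ℝ E) : Set E) = ⋃ n, (W n : Set E) :=
    Submodule.coe_iSup_of_directed _ hmono.directed_le
  have hle : ∀ n, W n ≤ (⨆ n, W n).topologicalClosure := fun n =>
    (le_iSup W n).trans (Submodule.le_topologicalClosure _)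
  refine ⟨(⨆ n, W n).topologicalClosure, fun e he => hle 0 (hW0 ▸ Submodule.subset_span he),
    Submodule.isClosed_topologicalClosure _, ?_, ?_⟩
  · have : IsSeparable ((⨆ n, W n).topologicalClosure : Set E) := by
      rw [Submodule.topologicalClosure_coe, hcoe]
      exact (IsSeparable.iUnion hsep).closure
    exact this.separableSpace
  · intro m k a y ha η hη
    -- The tuple in the closure is exchanged for one in some `W n` and back, at `m` shares each; the
    -- imitation costs one.
    have hδ : 0 < η / (2 * m + 1) := by positivity
    have h1 : ∀ i, ∃ b, (∃ n, b ∈ W n) ∧ ‖a i - b‖ ≤ η / (2 * m + 1) := by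
      intro i
      have h := ha i
      rw [← SetLike.mem_coe, Submodule.topologicalClosure_coe, hcoe] at h
      obtain ⟨b, hb, hab⟩ := Metric.mem_closure_iff.1 h _ hδ
      exact ⟨b, Set.mem_iUnion.1 hb, by rw [← dist_eq_norm]; exact hab.le⟩
    choose b hb hab using h1
    choose n hn using hb
    obtain ⟨d, hd, h⟩ := (hS' _ (hsep (Finset.univ.sup n))).2 m k b y
      (fun i => hmono (Finset.le_sup (Finset.mem_univ i)) (hn i)) _ hδ
    refine ⟨d, fun j => hle (Finset.univ.sup n + 1) ?_, fun c => ?_⟩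
    · rw [hW]
      exact hd j
    · have h2 := abs_combinationNorm_sub_le a b y hab c
      have h3 := abs_combinationNorm_sub_le b a d (fun i => by rw [norm_sub_rev]; exact hab i) c
      have h4 : m * (η / (2 * m + 1)) + (η / (2 * m + 1) + m * (η / (2 * m + 1))) = η := by
        field_simp
        ring
      exact (abs_sub_le _ _ _).trans
        ((add_le_add h2 ((abs_sub_le _ _ _).trans (add_le_add (h c) h3))).trans h4.le)

end

/-! ### Imitation gives ideals; the separable reduction -/

section

variable {E : Type*} [NormedAddCommGroup E] [NormedSpace ℝ E]

open TopologicalSpace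

/-- By homogeneity, the uniform estimate on the unit ball of coefficients becomes a relative one. -/
theorem abs_norm_combination_sub_le {m k : ℕ} {a : Fin m → E} {y d : Fin k → E} {η : ℝ}
    (h : ∀ c, |combinationNorm a y c - combinationNorm a d c| ≤ η)
    (p : (Fin m → ℝ) × (Fin k → ℝ)) :
    |‖∑ i, p.1 i • a i + ∑ j, p.2 j • y j‖ - ‖∑ i, p.1 i • a i + ∑ j, p.2 j • d j‖|
      ≤ η * ‖p‖ := by
  by_cases hp : p = 0
  · simp [hp]
  · have hpos : 0 < ‖p‖ := norm_pos_iff.2 hp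
    have key : ∀ v : Fin k → E, ‖∑ i, p.1 i • a i + ∑ j, p.2 j • v j‖ =
        ‖p‖ * ‖∑ i, (‖p‖⁻¹ • p).1 i • a i + ∑ j, (‖p‖⁻¹ • p).2 j • v j‖ := by
      intro v
      simp only [Prod.smul_fst, Prod.smul_snd, Pi.smul_apply, smul_assoc, ← Finset.smul_sum,
        ← smul_add]
      rw [norm_smul, norm_inv, norm_norm, mul_inv_cancel_left₀ hpos.ne']
    rw [key y, key d, ← mul_sub, abs_mul, abs_of_pos hpos, mul_comm]
    refine mul_le_mul_of_nonneg_right (h ⟨‖p‖⁻¹ • p, ?_⟩) hpos.le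
    rw [mem_closedBall_zero_iff, norm_smul, norm_inv, norm_norm, inv_mul_cancel₀ hpos.ne']

/-- A subspace that imitates the position of tuples of points of the whole space is an almost
isometric ideal. -/
theorem isAlmostIsometricIdeal_of_imitating {Z : Submodule ℝ E}
    (hZ : ∀ (m k : ℕ) (a : Fin m → E) (y : Fin k → E), (∀ i, a i ∈ Z) →
      ∀ η > 0, ∃ d : Fin k → E, (∀ j, d j ∈ Z) ∧
        ∀ c, |combinationNorm a y c - combinationNorm a d c| ≤ η) :
    IsAlmostIsometricIdeal Z := by
  intro ε hε F hF
  -- `T` will fix a basis of `F ∩ Z` and send a basis of a complement to imitating vectors of `Z`.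
  let P : Submodule ℝ F := Z.comap F.subtype
  obtain ⟨Q, hPQ⟩ := P.exists_isCompl
  let bP := Module.finBasis ℝ P
  let bQ := Module.finBasis ℝ Q
  let Φ := (Submodule.prodEquivOfIsCompl P Q hPQ).symm.trans
    (LinearEquiv.prodCongr bP.equivFun bQ.equivFun)
  obtain ⟨C, hC, hΦ⟩ := (LinearMap.toContinuousLinearMap Φ.toLinearMap).bound
  -- Coordinates have size at most `C * ‖x‖`, so precision `ε / C` gives error `ε * ‖x‖`.
  obtain ⟨d, hd, h⟩ := hZ _ _ (fun i => ((bP i : F) : E)) (fun j => ((bQ j : F) : E))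
    (fun i => (bP i).2) (ε / C) (by positivity)
  let T : F →ₗ[ℝ] Z := (LinearMap.coprod
    (Fintype.linearCombination ℝ fun i => (⟨((bP i : F) : E), (bP i).2⟩ : Z))
    (Fintype.linearCombination ℝ fun j => (⟨d j, hd j⟩ : Z))) ∘ₗ Φ.toLinearMap
  have hT : ∀ x : F, ((T x : Z) : E) =
      ∑ i, (Φ x).1 i • ((bP i : F) : E) + ∑ j, (Φ x).2 j • d j := by
    intro x
    simp [T, Fintype.linearCombination_apply]
  have hx : ∀ x : F, (x : E) =
      ∑ i, (Φ x).1 i • ((bP i : F) : E) + ∑ j, (Φ x).2 j • ((bQ j : F) : E) := by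
    intro x
    have h1 := (Submodule.prodEquivOfIsCompl P Q hPQ).apply_symm_apply x
    set w := (Submodule.prodEquivOfIsCompl P Q hPQ).symm x with hw
    have h2 : (Φ x).1 = bP.equivFun w.1 := rfl
    have h3 : (Φ x).2 = bQ.equivFun w.2 := rfl
    have h4 := congrArg (fun v : P => ((v : F) : E)) (bP.sum_equivFun w.1)
    have h5 := congrArg (fun v : Q => ((v : F) : E)) (bQ.sum_equivFun w.2)
    simp only [Submodule.coe_sum, Submodule.coe_smul] at h4 h5
    rw [h2, h3, h4, h5, ← h1]
    simp
  have hest : ∀ x : F, |‖x‖ - ‖T x‖| ≤ ε * ‖x‖ := by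
    intro x
    have h1 := abs_norm_combination_sub_le h (Φ x)
    rw [← hx, ← hT] at h1
    refine h1.trans ((mul_le_mul_of_nonneg_left (hΦ x) (by positivity)).trans ?_)
    rw [← mul_assoc, div_mul_cancel₀ _ hC.ne']
  refine ⟨T, fun x hxZ => ?_, fun x => ?_⟩
  · have h1 : (Φ x).2 = 0 := by
      have h2 := Submodule.prodEquivOfIsCompl_symm_apply_left P Q hPQ ⟨x, hxZ⟩
      change bQ.equivFun ((Submodule.prodEquivOfIsCompl P Q hPQ).symm x).2 = 0
      rw [show (Submodule.prodEquivOfIsCompl P Q hPQ).symm x = _ from h2]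
      simp
    rw [hT, hx x, h1]
    simp
  · have h1 := abs_le.1 (hest x)
    constructor <;> linarith [h1.1, h1.2]

/-- The norm of a functional is determined on a countable set. -/
theorem exists_countable_norming {x : StrongDual ℝ E} (hx : x ≠ 0) :
    ∃ B : Set E, B.Countable ∧ ∀ Z : Submodule ℝ E, B ⊆ Z → ‖x ∘L Z.subtypeL‖ = ‖x‖ := by
  have h : ∀ n : ℕ, ∃ e : E, max 0 (‖x‖ - 1 / (n + 1 : ℝ)) * ‖e‖ < ‖x e‖ := fun n =>
    x.exists_mul_lt_of_lt_opNorm (le_max_left _ _)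
      (max_lt (norm_pos_iff.2 hx) (sub_lt_self _ (by positivity)))
  choose e he using h
  refine ⟨Set.range e, Set.countable_range e, fun Z hZ => le_antisymm ?_ ?_⟩
  · exact ContinuousLinearMap.opNorm_le_bound _ (norm_nonneg x) fun z => x.le_opNorm z
  · have key : ∀ n : ℕ, ‖x‖ ≤ ‖x ∘L Z.subtypeL‖ + 1 / (n + 1 : ℝ) := by
      intro n
      have h1 := (x ∘L Z.subtypeL).le_opNorm ⟨e n, hZ ⟨n, rfl⟩⟩
      have h2 : max 0 (‖x‖ - 1 / (n + 1 : ℝ)) * ‖e n‖ < ‖x ∘L Z.subtypeL‖ * ‖e n‖ :=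
        (he n).trans_le h1
      have h3 := (le_max_right _ _).trans (lt_of_mul_lt_mul_right h2 (norm_nonneg _)).le
      linarith
    refine ge_of_tendsto' (x := Filter.atTop) (f := fun n : ℕ => ‖x ∘L Z.subtypeL‖ + 1 / (n + 1 : ℝ)) ?_ key
    simpa using tendsto_one_div_add_atTop_nhds_zero_nat.const_add ‖x ∘L Z.subtypeL‖

/-- The zero functional attains its norm as soon as its evaluation functional does. -/
theorem isNormAttaining_zero_of_delta
    (h : IsNormAttaining (delta (0 : StrongDual ℝ E))) :
    IsNormAttaining (0 : StrongDual ℝ E) := by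
  obtain ⟨f, hf, -⟩ := h
  by_cases hE : ∃ e : E, e ≠ 0
  · obtain ⟨e, he⟩ := hE
    refine ⟨‖e‖⁻¹ • e, ?_, by simp⟩
    rw [norm_smul, norm_inv, norm_norm, inv_mul_cancel₀ (norm_ne_zero_iff.2 he)]
  · push Not at hE
    -- On the zero space the only functional is `0`, where positively homogeneous functions vanish.
    have hf0 : f = 0 := by
      refine Subtype.ext (Subtype.ext (funext fun y => ?_))
      have hy : y = 0 := ContinuousLinearMap.ext fun e => by rw [hE e]; simp
      have h := abs_apply_le f.1 y
      rw [hy, norm_zero, zero_mul] at h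
      rw [hy]
      exact abs_nonpos_iff.1 h
    rw [hf0, norm_zero] at hf
    exact absurd hf zero_ne_one

/-- Failure of the norm-attaining equivalence is separably determined. -/
theorem exists_separable_ideal (hE : ¬ NormAttainingEquivalence E) :
    ∃ Z : Submodule ℝ E, IsClosed (Z : Set E) ∧ SeparableSpace Z ∧
      IsAlmostIsometricIdeal Z ∧ ¬ NormAttainingEquivalence Z := by
  simp only [NormAttainingEquivalence, not_forall] at hE
  obtain ⟨x, hx⟩ := hE
  have hdx : IsNormAttaining (delta x) := by
    by_contra h
    exact hx ⟨isNormAttaining_delta, fun h' => absurd h' h⟩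
  have hxn : ¬ IsNormAttaining x := fun h => hx ⟨fun _ => hdx, fun _ => h⟩
  have hx0 : x ≠ 0 := by
    rintro rfl
    exact hxn (isNormAttaining_zero_of_delta hdx)
  obtain ⟨⟨f, hf⟩, hf1, hfx⟩ := hdx
  rw [norm_delta] at hfx
  obtain ⟨A, hA, hfA⟩ := exists_countable_mem_fblOn hf
  obtain ⟨B, hB, hxB⟩ := exists_countable_norming hx0
  obtain ⟨Z, hABZ, hZc, hZs, hZi⟩ := exists_imitating_submodule (hA.union hB)
  have hZ := isAlmostIsometricIdeal_of_imitating hZi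
  have hxZ := hxB Z (Set.subset_union_right.trans hABZ)
  refine ⟨Z, hZc, hZs, hZ, fun h => hxn ?_⟩
  obtain ⟨φ, hφ, hext⟩ := exists_extension hZ
  obtain ⟨z, hz, hxz⟩ := (h (x ∘L Z.subtypeL)).2 (isNormAttaining_delta_restrict φ hφ hext
    (Set.subset_union_left.trans hABZ) hfA hx0 hf1 hfx hxZ)
  exact ⟨z, hz, hxz.trans hxZ⟩

end

end FreeBanachLattice

end

theorem mainTheorem7 (E : Type u) [NormedAddCommGroup E] [NormedSpace ℝ E]
    [CompleteSpace E] :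
    (¬ NormAttainingEquivalence E →
      ∃ Z : Submodule ℝ E, IsClosed (Z : Set E) ∧ TopologicalSpace.SeparableSpace Z ∧
        IsAlmostIsometricIdeal Z ∧ ¬ NormAttainingEquivalence Z) ∧
    ((∀ (F : Type u) [NormedAddCommGroup F] [NormedSpace ℝ F] [CompleteSpace F]
        [TopologicalSpace.SeparableSpace F], NormAttainingEquivalence F) →
      NormAttainingEquivalence E) := by
  refine ⟨FreeBanachLattice.exists_separable_ideal, fun h => ?_⟩
  by_contra hE
  obtain ⟨Z, hZc, hZs, -, hZ⟩ := FreeBanachLattice.exists_separable_ideal hE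
  have : CompleteSpace Z := hZc.completeSpace_coe
  exact hZ (h Z)
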